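/- Conventions. A group $G$ is *pseudofinite* if every first-order sentence in the language of groups that is true in all finite groups is true in $G$ (finite groups are allowed). It is *$\aleph_0$-saturated* if for every finite set $A\subseteq G$ and every $n\in\mathbb N$, every set of formulas of the language of groups in $n$ free variables with parameters in $A$ which is finitely satisfiable in $G$ is realized in $G$. $F_2$ denotes the free group on two generators, and $G$ *contains $F_2$* if $F_2$ embeds into $G$. $G$ *satisfies a nontrivial identity* if for some $n$ there is a nontrivial element $w$ of the free group on $x_1,\dots,x_n$ with $w(g_1,\dots,g_n)=1$ for all $g_1,\dots,g_n\in G$. $G$ is *amenable* if there is a finitely additive left-invariant measure $\mu:\mathcal P(G)\to[0,1]$ with $\mu(G)=1$. $G$ is *uniformly amenable* if there is a function $\alpha:(0,1]\times\mathbb N\to\mathbb N$ such that for every $\epsilon\in(0,1]$ and every finite subset $A\subseteq G$ there is a finite subset $V\subseteq G$ with $|V|\le\alpha(\epsilon,|A|)$ and $|AV|<(1+\epsilon)|V|$. Theorem. The following statements are equivalent. 1. Every $\aleph_0$-saturated pseudofinite group contains $F_2$ or is amenable. 2. Every ultraproduct of finite groups (over an arbitrary index set and with respect to an arbitrary ultrafilter)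 contains $F_2$ or is amenable. 3. Every finitely generated residually finite group satisfying a nontrivial identity is amenable. 4. Every finitely generated residually finite group satisfying a nontrivial identity is uniformly amenable. -/

import Mathlib

open FirstOrder

universe u v

/-! ### The first-order language of groups -/

/-- Function symbols of the language of groups: `1`, `⁻¹`, `*`. -/
inductive GroupFunc : ℕ → Type
  | one : GroupFunc 0
  | inv : GroupFunc 1
  | mul : GroupFunc 2

/-- The first-order language of groups. -/
def groupLanguage : FirstOrder.Language.{0, 0} where
  Functions := GroupFunc
  Relations := fun _ => Empty

/-- A group, seen as a structure for the language of groups. -/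
@[reducible]
def groupStructure (G : Type u) [Group G] : groupLanguage.Structure G where
  funMap := fun {_} f =>
    match f with
    | GroupFunc.one => fun _ => 1
    | GroupFunc.inv => fun x => (x 0)⁻¹
    | GroupFunc.mul => fun x => x 0 * x 1
  RelMap := fun {_} r _ => Empty.elim r

/-! ### Saturation and pseudofiniteness -/

/-- A structure `M` is `ℵ₀`-saturated if for every finite set of parameters `A ⊆ M` and every `n`,
every set of formulas in `n` free variables with parameters in `A` that is finitely satisfiable
in `M` is realized in `M`. -/
def IsAlephZeroSaturated (L : FirstOrder.Language.{0, 0}) (M : Type u) [L.Structure M] : Prop :=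
  ∀ A : Set M, A.Finite → ∀ (n : ℕ) (p : Set ((L.withConstants A).Formula (Fin n))),
    (∀ q : Set ((L.withConstants A).Formula (Fin n)), q ⊆ p → q.Finite →
      ∃ v : Fin n → M, ∀ φ ∈ q, φ.Realize v) →
    ∃ v : Fin n → M, ∀ φ ∈ p, φ.Realize v

/-- A group is `ℵ₀`-saturated if it is so as a structure for the language of groups. -/
def IsAlephZeroSaturatedGroup (G : Type u) [Group G] : Prop :=
  letI := groupStructure G
  IsAlephZeroSaturated groupLanguage G

/-- A sentence of the language of groups holds in the group `G`. -/
def GroupSatisfies (G : Type u) [Group G] (φ : groupLanguage.Sentence) : Prop :=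
  letI := groupStructure G
  G ⊨ φ

/-- A group is pseudofinite if it is a model of the theory of the class of finite groups, that is,
every sentence that holds in all finite groups holds in it. (Finite groups are allowed.) -/
def IsPseudofiniteGroup (G : Type u) [Group G] : Prop :=
  ∀ φ : groupLanguage.Sentence,
    (∀ (F : Type u) [Group F] [Finite F], GroupSatisfies F φ) → GroupSatisfies G φ

/-! ### Ultraproducts of groups -/

/-- The ultraproduct of the family `F` relative to the ultrafilter `U`: the quotient of the
product by the relation of being equal on a set in `U`. -/
def GroupUltraproduct {I : Type u} (U : Ultrafilter I) (F : I → Type v) : Type (max u v) :=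
  (U : Filter I).Product F

/-- The group structure on an ultraproduct of groups, induced by the pointwise operations. -/
instance GroupUltraproduct.instGroup {I : Type u} (U : Ultrafilter I) (F : I → Type v)
    [∀ i, Group (F i)] : Group (GroupUltraproduct U F) where
  one := Quotient.mk ((U : Filter I).productSetoid F) 1
  mul := Quotient.map₂ (· * ·) fun _ _ h₁ _ _ h₂ => by
    filter_upwards [h₁, h₂] with i hi₁ hi₂
    simp [hi₁, hi₂]
  inv := Quotient.map (·⁻¹) fun _ _ h => by
    filter_upwards [h] with i hi
    simp [hi]
  mul_assoc := by
    rintro ⟨x⟩ ⟨y⟩ ⟨z⟩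
    exact congrArg (Quotient.mk ((U : Filter I).productSetoid F)) (mul_assoc x y z)
  one_mul := by
    rintro ⟨x⟩
    exact congrArg (Quotient.mk ((U : Filter I).productSetoid F)) (one_mul x)
  mul_one := by
    rintro ⟨x⟩
    exact congrArg (Quotient.mk ((U : Filter I).productSetoid F)) (mul_one x)
  inv_mul_cancel := by
    rintro ⟨x⟩
    exact congrArg (Quotient.mk ((U : Filter I).productSetoid F)) (inv_mul_cancel x)

/-! ### Free subgroups, identities, amenability -/

/-- The group contains a free group of rank two. -/
def ContainsFreeGroup (G : Type u) [Group G] : Prop :=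
  ∃ f : FreeGroup (Fin 2) →* G, Function.Injective f

/-- The group satisfies a nontrivial identity: there is a nontrivial element `w` of a free group
on `n` generators such that `w(g₁, …, gₙ) = 1` for all `g₁, …, gₙ` in the group. -/
def SatisfiesNontrivialIdentity (G : Type u) [Group G] : Prop :=
  ∃ (n : ℕ) (w : FreeGroup (Fin n)), w ≠ 1 ∧ ∀ g : Fin n → G, FreeGroup.lift g w = 1

/-- The group is amenable: it has a left-invariant finitely additive probability measure defined
on all its subsets. -/
def IsAmenableGroup (G : Type u) [Group G] : Prop :=
  ∃ μ : Set G → ℝ, (∀ A, μ A ∈ Set.Icc (0 : ℝ) 1) ∧ μ Set.univ = 1 ∧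
    (∀ A B, Disjoint A B → μ (A ∪ B) = μ A + μ B) ∧
    ∀ (g : G) (A : Set G), μ ((fun x => g * x) '' A) = μ A

open Classical Pointwise in
/-- The group is uniformly amenable: there is a function `α` such that for every `ε ∈ (0, 1]` and
every finite subset `A` there is a finite subset `V` with `|V| ≤ α(ε, |A|)` and
`|AV| < (1 + ε)|V|` (which forces `V` to be nonempty). -/
def IsUniformlyAmenableGroup (G : Type u) [Group G] : Prop :=
  ∃ α : ℝ → ℕ → ℕ, ∀ ε : ℝ, 0 < ε → ε ≤ 1 → ∀ A : Finset G, ∃ V : Finset G,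
    V.card ≤ α ε A.card ∧ ((A * V).card : ℝ) < (1 + ε) * V.card

/-! Statement 3 is the hub. From 3 to 1 and 2: by compactness, a saturated group or an ultraproduct
of finite groups without a free subgroup satisfies an identity. Either one pair avoids all
nontrivial words, or finitely many words suffice for every pair to kill one of them. Iterating the
commutator `⁅w₁, t * w₂ * t⁻¹⁆` with a new variable `t` (`commutator_conj_ne_one`) merges these
words into a single identity. Amenability is then local by Følner's criterion, and each finitely
generated subgroup is a quotient of a finitely generated subgroup of a product of finite groups
satisfying the identity. The latter is residually finite, so 3 applies
(`isAmenableGroup_of_approximable`). Conversely, a residually finite group with an identity embeds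
into an ultraproduct of its finite quotients. That ultraproduct inherits the identity, so it
contains no free group and must be amenable, and amenability passes to subgroups. For 1, a finitely
generated group is countable, so a nonprincipal ultrafilter on `ℕ` suffices, and such ultraproducts
are `ℵ₀`-saturated (`isAlephZeroSaturated_product`). From 3 to 4: finite sets witnessing failure of
uniformity combine into one finite set in a power of the group, and a Følner set for it projects to
a contradiction. -/

/-! ### Invariant means and Følner sets -/

section Amenability

open scoped Classical Pointwise

/-- A finitely additive set function is additive on finite disjoint unions. -/
theorem sum_eq_of_finitelyAdditive {X ι : Type*} (μ : Set X → ℝ)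
    (hμ : ∀ A B, Disjoint A B → μ (A ∪ B) = μ A + μ B) (s : Finset ι) (C : ι → Set X)
    (hC : (s : Set ι).PairwiseDisjoint C) :
    μ (⋃ i ∈ s, C i) = ∑ i ∈ s, μ (C i) := by
  induction s using Finset.induction_on with
  | empty =>
    have := hμ ∅ ∅ (by simp)
    simp only [Set.union_self] at this
    simpa using this
  | insert a s ha ih =>
    rw [Finset.set_biUnion_insert, Finset.sum_insert ha, hμ, ih]
    · exact hC.subset (by simp)
    · rw [Set.disjoint_iUnion₂_right]
      intro i hi
      exact hC (by simp) (by simp [hi]) (by rintro rfl; exact ha hi)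

/-- An expanding finite subset of a group has a power which is doubling. -/
theorem exists_doubling_of_expanding {G : Type*} [Group G] {ε : ℝ} (hε : 0 < ε) {A : Finset G}
    (hA : ∀ V : Finset G, (1 + ε) * V.card ≤ ((A * V).card : ℝ)) :
    ∃ B : Finset G, ∀ V : Finset G, 2 * V.card ≤ (B * V).card := by
  obtain ⟨m, hm⟩ := pow_unbounded_of_one_lt (2 : ℝ) (by linarith : 1 < 1 + ε)
  have key : ∀ (m : ℕ) (V : Finset G), (1 + ε) ^ m * V.card ≤ ((A ^ m * V).card : ℝ) := by
    intro m
    induction m with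
    | zero => intro V; simp
    | succ m ih =>
      intro V
      have h1 := ih (A * V)
      rw [← mul_assoc, ← pow_succ] at h1
      refine le_trans ?_ h1
      rw [pow_succ, mul_assoc]
      exact mul_le_mul_of_nonneg_left (hA V) (by positivity)
  refine ⟨A ^ m, fun V => ?_⟩
  have := (mul_le_mul_of_nonneg_right hm.le (Nat.cast_nonneg V.card)).trans (key m V)
  exact_mod_cast this

/-- A doubling finite subset of a group yields, by Hall's theorem, an injective map exhibiting a
paradoxical decomposition. -/
theorem exists_injective_of_doubling {G : Type*} [Group G] {B : Finset G}
    (hB : ∀ V : Finset G, 2 * V.card ≤ (B * V).card) :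
    ∃ f : G × Bool → G, Function.Injective f ∧ ∀ x, f x * x.1⁻¹ ∈ B := by
  -- Both copies of `g` may be matched with any element of `B * {g}`. A finite set of pairs is at
  -- most twice as large as its projection to `G`, so doubling gives Hall's condition.
  obtain ⟨f, hf, hfB⟩ := (Finset.all_card_le_biUnion_card_iff_exists_injective
    (fun x : G × Bool => B * {x.1})).1 (fun s => by
      have h1 : s.card ≤ 2 * (s.image Prod.fst).card := by
        have : s ⊆ (s.image Prod.fst) ×ˢ (Finset.univ : Finset Bool) := fun x hx => by
          simp only [Finset.mem_product, Finset.mem_univ, and_true]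
          exact Finset.mem_image_of_mem _ hx
        have := Finset.card_le_card this
        simp only [Finset.card_product, Finset.card_univ, Fintype.card_bool] at this
        omega
      refine h1.trans ((hB _).trans (Finset.card_le_card ?_))
      intro y hy
      obtain ⟨b, hb, c, hc, rfl⟩ := Finset.mem_mul.1 hy
      obtain ⟨x, hx, rfl⟩ := Finset.mem_image.1 hc
      exact Finset.mem_biUnion.2 ⟨x, hx, Finset.mul_mem_mul hb (Finset.mem_singleton_self _)⟩)
  refine ⟨f, hf, fun x => ?_⟩
  obtain ⟨b, hb, c, hc, h⟩ := Finset.mem_mul.1 (hfB x)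
  rw [Finset.mem_singleton.1 hc] at h
  rw [← h]
  simpa using hb

/-- Amenable groups have Følner sets. -/
theorem IsAmenableGroup.exists_folner {G : Type*} [Group G] (hG : IsAmenableGroup G) {ε : ℝ}
    (hε : 0 < ε) (A : Finset G) :
    ∃ V : Finset G, ((A * V).card : ℝ) < (1 + ε) * V.card := by
  by_contra! hA
  obtain ⟨B, hB⟩ := exists_doubling_of_expanding hε hA
  obtain ⟨f, hf, hfB⟩ := exists_injective_of_doubling hB
  obtain ⟨μ, hμ01, hμ1, hμ, hinv⟩ := hG
  -- For fixed `i`, the pieces `C (i, b)` with `b ∈ B` partition the group. Since `f` is injective,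
  -- all translates `D (i, b)` are disjoint, so their total mass 2 would have to be at most 1.
  let C : Bool × G → Set G := fun p => {g | f (g, p.1) * g⁻¹ = p.2}
  let D : Bool × G → Set G := fun p => (fun x => p.2 * x) '' C p
  have hD : ∀ p, ∀ y ∈ D p, ∃ g, g ∈ C p ∧ y = f (g, p.1) := by
    rintro p y ⟨g, hg, rfl⟩
    exact ⟨g, hg, by rw [← (show f (g, p.1) * g⁻¹ = p.2 from hg)]; simp⟩
  have hCsum : ∀ i : Bool, ∑ b ∈ B, μ (C (i, b)) = 1 := by
    intro i
    rw [← sum_eq_of_finitelyAdditive μ hμ B (fun b => C (i, b)), ← hμ1]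
    · congr 1
      ext g
      simpa [C] using hfB (g, i)
    · intro b _ b' _ hbb'
      refine Set.disjoint_left.2 fun g hg hg' => hbb' ?_
      exact (show f (g, i) * g⁻¹ = b from hg).symm.trans hg'
  have hDsum : ∑ p ∈ (Finset.univ : Finset Bool) ×ˢ B, μ (D p) ≤ 1 := by
    rw [← sum_eq_of_finitelyAdditive μ hμ]
    · exact (hμ01 _).2
    · rintro p _ q _ hpq
      refine Set.disjoint_left.2 fun y hp hq => hpq ?_
      obtain ⟨g, hg, rfl⟩ := hD p y hp
      obtain ⟨g', hg', h⟩ := hD q _ hq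
      have h3 := hf h
      simp only [Prod.mk.injEq] at h3
      obtain ⟨rfl, h4⟩ := h3
      refine Prod.ext h4 ?_
      rw [← (show f (g, p.1) * g⁻¹ = p.2 from hg), ← (show f (g, q.1) * g⁻¹ = q.2 from hg'), h4]
  have : ∑ p ∈ (Finset.univ : Finset Bool) ×ˢ B, μ (D p) = 2 := by
    rw [Finset.sum_product]
    simp only [D, hinv, hCsum]
    simp
  linarith

/-- A group with Følner sets is amenable. -/
theorem isAmenableGroup_of_folner {G : Type*} [Group G]
    (hG : ∀ ε : ℝ, 0 < ε → ∀ A : Finset G,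
      ∃ V : Finset G, ((A * V).card : ℝ) < (1 + ε) * V.card) :
    IsAmenableGroup G := by
  -- Adding `1` to the finite set gives `V ⊆ A * V`, so the Følner inequality bounds the number of
  -- elements of `A * V` outside `V`. The mean will be a limit of relative densities in these sets.
  choose V hV using fun i : Finset G × ℕ =>
    hG (1 / (i.2 + 1)) Nat.one_div_pos_of_nat (insert 1 i.1)
  have hpos : ∀ i, (0 : ℝ) < (V i).card := by
    intro i
    have h := hV i
    have h0 : (0 : ℝ) ≤ ((insert 1 i.1 * V i).card : ℝ) := by positivity
    have h1 : (0 : ℝ) < 1 + 1 / (i.2 + 1) := by positivity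
    exact pos_of_mul_pos_right (h0.trans_lt h) h1.le
  let U : Ultrafilter (Finset G × ℕ) := Ultrafilter.of Filter.atTop
  have hU : (U : Filter (Finset G × ℕ)) ≤ Filter.atTop := Ultrafilter.of_le _
  let r : Set G → Finset G × ℕ → ℝ := fun S i => ((V i).filter (· ∈ S)).card / (V i).card
  have hr01 : ∀ S i, r S i ∈ Set.Icc (0 : ℝ) 1 := by
    intro S i
    refine ⟨by positivity, div_le_one_of_le₀ ?_ (hpos i).le⟩
    exact_mod_cast Finset.card_filter_le _ _
  have hlim : ∀ S, ∃ x ∈ Set.Icc (0 : ℝ) 1, Filter.Tendsto (r S) U (nhds x) := fun S =>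
    isCompact_Icc.ultrafilter_le_nhds (U.map (r S)) (by
      simp only [Ultrafilter.coe_map, Filter.le_principal_iff]
      exact Filter.mem_map.2 (Filter.univ_mem' (hr01 S)))
  choose μ hμ01 hμ using hlim
  -- One inequality is enough: the reverse one follows by applying it to `g⁻¹` and the translated
  -- set.
  have hle : ∀ g S, μ ((fun x => g * x) '' S) ≤ μ S := by
    intro g S
    have hlim0 : Filter.Tendsto (fun i : Finset G × ℕ => r S i + 1 / ((i.2 : ℝ) + 1)) U
        (nhds (μ S + 0)) := by
      refine (hμ S).add ?_
      refine Filter.Tendsto.mono_left ?_ hU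
      rw [← Filter.prod_atTop_atTop_eq]
      exact tendsto_one_div_add_atTop_nhds_zero_nat.comp Filter.tendsto_snd
    rw [add_zero] at hlim0
    refine le_of_tendsto_of_tendsto (hμ _) hlim0 ?_
    have hev : ∀ᶠ i in (U : Filter (Finset G × ℕ)), ({g⁻¹}, 0) ≤ i :=
      hU (Filter.eventually_ge_atTop _)
    filter_upwards [hev] with i hi
    have hgi : g⁻¹ ∈ i.1 := hi.1 (Finset.mem_singleton_self _)
    have hcard : (((V i).filter (· ∈ (fun x => g * x) '' S)).card : ℝ) ≤
        ((V i).filter (· ∈ S)).card + ((insert 1 i.1 * V i).card - (V i).card) := by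
      have hsub : ((V i).filter (· ∈ (fun x => g * x) '' S)).image (fun x => g⁻¹ * x) ⊆
          (V i).filter (· ∈ S) ∪ (insert 1 i.1 * V i) \ V i := by
        intro y hy
        obtain ⟨x, hx, rfl⟩ := Finset.mem_image.1 hy
        obtain ⟨hxV, z, hz, rfl⟩ := Finset.mem_filter.1 hx
        simp only [inv_mul_cancel_left]
        by_cases hzV : z ∈ V i
        · exact Finset.mem_union_left _ (Finset.mem_filter.2 ⟨hzV, hz⟩)
        · refine Finset.mem_union_right _ (Finset.mem_sdiff.2 ⟨?_, hzV⟩)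
          simpa using Finset.mul_mem_mul (Finset.mem_insert_of_mem hgi : g⁻¹ ∈ insert 1 i.1) hxV
      have h1 := (Finset.card_le_card hsub).trans (Finset.card_union_le _ _)
      rw [Finset.card_image_of_injective _ (mul_right_injective _)] at h1
      have h2 : V i ⊆ insert 1 i.1 * V i := fun x hx => by
        simpa using Finset.mul_mem_mul (Finset.mem_insert_self 1 i.1) hx
      have h3 := Finset.card_sdiff_add_card_eq_card h2
      have h1' : (((V i).filter (· ∈ (fun x => g * x) '' S)).card : ℝ) ≤
        ((V i).filter (· ∈ S)).card + (((insert 1 i.1 * V i) \ V i).card : ℝ) := by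
        exact_mod_cast h1
      have h3' : ((((insert 1 i.1 * V i) \ V i).card : ℝ)) + (V i).card =
        (insert 1 i.1 * V i).card := by exact_mod_cast h3
      linarith
    simp only [r]
    rw [div_le_iff₀ (hpos i), add_mul, div_mul_cancel₀ _ (hpos i).ne']
    have := hV i
    linarith
  refine ⟨μ, hμ01, ?_, ?_, ?_⟩
  · refine tendsto_nhds_unique (hμ Set.univ) ?_
    have : r Set.univ = fun _ => 1 := by
      funext i
      simp [r, (hpos i).ne']
    rw [this]
    exact tendsto_const_nhds
  · intro A B hAB
    refine tendsto_nhds_unique (hμ (A ∪ B)) ?_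
    convert (hμ A).add (hμ B) using 1
    funext i
    simp only [r, ← add_div]
    congr 1
    rw [← Nat.cast_add, ← Finset.card_union_of_disjoint]
    · congr 2
      ext x
      simp [and_or_left]
    · refine Finset.disjoint_left.2 fun x hx hx' => ?_
      exact Set.disjoint_left.1 hAB (Finset.mem_filter.1 hx).2 (Finset.mem_filter.1 hx').2
  · intro g A
    refine le_antisymm (hle g A) ?_
    have := hle g⁻¹ ((fun x => g * x) '' A)
    rwa [Set.image_image, show (fun x => g⁻¹ * (g * x)) = id by funext x; simp, Set.image_id]
      at this

/-- Means push forward along maps which are equivariant up to translations. -/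
theorem IsAmenableGroup.of_equivariant {G H : Type*} [Group G] [Group H] (hG : IsAmenableGroup G)
    (τ : G → H) (hτ : ∀ h, ∃ g, ∀ x, τ (g * x) = h * τ x) : IsAmenableGroup H := by
  obtain ⟨μ, hμ01, hμ1, hμ, hinv⟩ := hG
  refine ⟨fun S => μ (τ ⁻¹' S), fun S => hμ01 _, hμ1,
    fun A B h => hμ _ _ (h.preimage τ), fun h A => ?_⟩
  obtain ⟨g, hg⟩ := hτ h
  refine (congrArg μ ?_).trans (hinv g (τ ⁻¹' A))
  ext x
  simp only [Set.mem_preimage, Set.mem_image]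
  constructor
  · rintro ⟨a, ha, hax⟩
    refine ⟨g⁻¹ * x, ?_, by simp⟩
    have := hg (g⁻¹ * x)
    rw [mul_inv_cancel_left, ← hax] at this
    rwa [← mul_left_cancel this]
  · rintro ⟨y, hy, rfl⟩
    exact ⟨_, hy, (hg y).symm⟩

/-- Groups embedding into amenable groups are amenable. -/
theorem IsAmenableGroup.of_injective {G H : Type*} [Group G] [Group H] (hG : IsAmenableGroup G)
    (f : H →* G) (hf : Function.Injective f) : IsAmenableGroup H := by
  -- With a representative chosen in each right coset, `τ` takes the `H`-component of an element; it
  -- commutes with left translation by `H`.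
  let s := QuotientGroup.rightRel f.range
  have hex : ∀ g : G, ∃ h : H, f h = g * (Quotient.out (Quotient.mk s g))⁻¹ := fun g =>
    QuotientGroup.rightRel_apply.1 (Quotient.mk_out (s := s) g)
  choose τ hτ using hex
  refine hG.of_equivariant τ fun h => ⟨f h, fun x => hf ?_⟩
  have : Quotient.mk s (f h * x) = Quotient.mk s x := by
    refine Quotient.sound (QuotientGroup.rightRel_apply.2 ?_)
    exact ⟨h⁻¹, by simp⟩
  rw [map_mul, hτ, hτ, this, mul_assoc]

/-- Counting a finite set by the level sets of the fibre cardinalities of a map. -/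
theorem sum_card_levelSets {X Y : Type*} (f : X → Y) (V : Finset X) {N : ℕ} (hN : V.card ≤ N) :
    ∑ t ∈ Finset.range N,
      ((V.image f).filter fun y => t < (V.filter fun x => f x = y).card).card = V.card := by
  simp only [Finset.card_filter _ (V.image f)]
  rw [Finset.sum_comm, Finset.card_eq_sum_card_image f V]
  refine Finset.sum_congr rfl fun y _ => ?_
  rw [← Finset.card_filter]
  have : (Finset.range N).filter (fun t => t < (V.filter fun x => f x = y).card) =
      Finset.range (V.filter fun x => f x = y).card := by
    ext t
    simp only [Finset.mem_filter, Finset.mem_range, and_iff_right_iff_imp]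
    intro ht
    exact ht.trans_le ((Finset.card_filter_le _ _).trans hN)
  rw [this, Finset.card_range]

/-- Følner sets can be pushed along homomorphisms, without increasing the size. -/
theorem exists_folner_of_monoidHom {G H : Type*} [Group G] [Group H] (f : H →* G) {ε : ℝ}
    {A V : Finset H} (hV : ((A * V).card : ℝ) < (1 + ε) * V.card) {B : Finset G}
    (hB : ∀ x ∈ B, ∃ a ∈ A, f a = x) :
    ∃ V' : Finset G, V'.card ≤ V.card ∧ ((B * V').card : ℝ) < (1 + ε) * V'.card := by
  by_contra! hcon
  -- Superlevel sets of the fibre cardinality. Translation by `a` injects the fibre over `y` into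
  -- the fibre over `f a * y`, so `B * L V t ⊆ L (A * V) t`. If every layer expanded, summing over
  -- `t` would make `V` expand.
  let L : Finset H → ℕ → Finset G := fun S t =>
    (S.image f).filter fun y => t < (S.filter fun x => f x = y).card
  have hL : ∀ t, (1 + ε) * (L V t).card ≤ ((L (A * V) t).card : ℝ) := by
    intro t
    refine (hcon (L V t) ((Finset.card_filter_le _ _).trans Finset.card_image_le)).trans ?_
    norm_cast
    refine Finset.card_le_card fun x hx => ?_
    obtain ⟨_, hfa, y, hy, rfl⟩ := Finset.mem_mul.1 hx
    obtain ⟨a, ha, rfl⟩ := hB _ hfa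
    obtain ⟨hy, hty⟩ := Finset.mem_filter.1 hy
    obtain ⟨v, hv, rfl⟩ := Finset.mem_image.1 hy
    refine Finset.mem_filter.2 ⟨?_, hty.trans_le ?_⟩
    · rw [← map_mul]
      exact Finset.mem_image_of_mem _ (Finset.mul_mem_mul ha hv)
    · refine Finset.card_le_card_of_injOn (fun x => a * x) ?_ (mul_right_injective a).injOn
      intro x hx
      obtain ⟨hx, hxv⟩ := Finset.mem_filter.1 hx
      exact Finset.mem_filter.2 ⟨Finset.mul_mem_mul ha hx, by simp [hxv]⟩
  -- The range is long enough to exhaust the layers of both `V` and `A * V`.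
  have h1 := Finset.sum_le_sum fun t (_ : t ∈ Finset.range (V.card + (A * V).card)) => hL t
  rw [← Finset.mul_sum] at h1
  have h2 := sum_card_levelSets f V (Nat.le_add_right V.card (A * V).card)
  have h3 := sum_card_levelSets f (A * V) (Nat.le_add_left (A * V).card V.card)
  rw [← Nat.cast_sum, ← Nat.cast_sum, h2, h3] at h1
  linarith

/-- Uniformly amenable groups are amenable. -/
theorem IsUniformlyAmenableGroup.isAmenableGroup {G : Type u} [Group G]
    (hG : IsUniformlyAmenableGroup G) : IsAmenableGroup G := by
  obtain ⟨α, hα⟩ := hG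
  refine isAmenableGroup_of_folner fun ε hε A => ?_
  obtain ⟨V, -, hV⟩ := hα (min ε 1) (by positivity) (min_le_right _ _) A
  refine ⟨V, hV.trans_le ?_⟩
  gcongr
  exact min_le_left _ _

end Amenability

/-! ### Words and identities -/

section Words

open scoped commutatorElement

theorem map_freeGroup_lift {α : Type*} {G H : Type*} [Group G] [Group H] (f : G →* H) (g : α → G)
    (w : FreeGroup α) : f (FreeGroup.lift g w) = FreeGroup.lift (f ∘ g) w :=
  FreeGroup.lift_unique (f.comp (FreeGroup.lift g)) (by simp)

theorem freeGroup_lift_map {α β : Type*} {G : Type*} [Group G] (ι : α → β) (g : β → G)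
    (w : FreeGroup α) :
    FreeGroup.lift g (FreeGroup.map ι w) = FreeGroup.lift (g ∘ ι) w :=
  FreeGroup.lift_unique ((FreeGroup.lift g).comp (FreeGroup.map ι)) (by simp)

/-- The free group of countable rank embeds into the free group of rank two. -/
theorem exists_injective_freeGroup_nat :
    ∃ θ : FreeGroup ℕ →* FreeGroup (Fin 2), Function.Injective θ := by
  -- `ψ` sends the first generator to the shift of `FreeGroup ℤ` and the second to the free
  -- generator `0`. The conjugates defining `θ` then become distinct free generators.
  let s : MulAut (FreeGroup ℤ) := FreeGroup.freeGroupCongr (Equiv.addRight (1 : ℤ))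
  let φ : Multiplicative ℤ →* MulAut (FreeGroup ℤ) := zpowersHom _ s
  let ψ : FreeGroup (Fin 2) →* FreeGroup ℤ ⋊[φ] Multiplicative ℤ := FreeGroup.lift
    ![SemidirectProduct.inr (Multiplicative.ofAdd 1), SemidirectProduct.inl (FreeGroup.of 0)]
  let θ : FreeGroup ℕ →* FreeGroup (Fin 2) := FreeGroup.lift fun i =>
    FreeGroup.of 0 ^ i * FreeGroup.of 1 * (FreeGroup.of 0 ^ i)⁻¹
  have hs : ∀ i : ℕ, (s ^ i) (FreeGroup.of 0) = FreeGroup.of (i : ℤ) := by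
    intro i
    induction i with
    | zero => simp
    | succ i ih =>
      rw [pow_succ', MulAut.mul_apply, ih]
      simp [s]
  have hcomp : ψ.comp θ = SemidirectProduct.inl.comp (FreeGroup.map fun i : ℕ => (i : ℤ)) := by
    ext1 i
    simp only [MonoidHom.comp_apply, θ, ψ, FreeGroup.lift_apply_of, map_mul, map_pow, map_inv,
      FreeGroup.map.of, Matrix.cons_val_zero, Matrix.cons_val_one]
    rw [← map_pow, ← map_inv, ← SemidirectProduct.inl_aut, ← hs i]
    congr 1
    simp [φ, ← ofAdd_nsmul]
  refine ⟨θ, Function.Injective.of_comp (f := ψ) ?_⟩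
  have : ⇑ψ ∘ ⇑θ = SemidirectProduct.inl ∘ (FreeGroup.map fun i : ℕ => (i : ℤ)) :=
    congrArg DFunLike.coe hcomp
  rw [this]
  exact SemidirectProduct.inl_injective.comp (FreeGroup.map_injective Nat.cast_injective)

/-- A group containing a free group of rank two satisfies no nontrivial identity. -/
theorem ContainsFreeGroup.not_satisfiesNontrivialIdentity {G : Type u} [Group G]
    (hG : ContainsFreeGroup G) : ¬ SatisfiesNontrivialIdentity G := by
  rintro ⟨n, w, hw, h⟩
  obtain ⟨f, hf⟩ := hG
  obtain ⟨θ, hθ⟩ := exists_injective_freeGroup_nat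
  let e : FreeGroup (Fin n) →* FreeGroup ℕ := FreeGroup.map (fun i => (i : ℕ))
  have he : Function.Injective e := FreeGroup.map_injective Fin.val_injective
  let F : FreeGroup (Fin n) →* G := f.comp (θ.comp e)
  have hF : Function.Injective F := hf.comp (hθ.comp he)
  refine hw (hF ?_)
  have := map_freeGroup_lift F FreeGroup.of w
  rw [FreeGroup.lift_of_apply] at this
  rw [this, h, map_one]

/-- Two permutations without fixed points of an infinite set stop commuting after conjugating one
of them suitably. -/
theorem exists_conj_not_commute {X : Type*} [Infinite X] {g h : Equiv.Perm X}
    (hg : ∀ x, g x ≠ x) (hh : ∀ x, h x ≠ x) :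
    ∃ σ : Equiv.Perm X, g * (σ * h * σ⁻¹) ≠ (σ * h * σ⁻¹) * g := by
  classical
  have p : X := Classical.arbitrary X
  obtain ⟨q, hq⟩ := Infinite.exists_notMem_finset {p, h p, h⁻¹ p}
  obtain ⟨r, hr⟩ := Infinite.exists_notMem_finset {p, g p}
  obtain ⟨s, hs⟩ := Infinite.exists_notMem_finset {p, g p, r, g r}
  simp only [Finset.mem_insert, Finset.mem_singleton, not_or] at hq hr hs
  have h1 : h q ≠ p := fun h' => hq.2.2 (by rw [← h']; simp)
  -- With `σ` carrying `(p, q, h p, h q)` to `(p, g p, r, s)`, the two products send `p` to `g r`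
  -- and to `s`, which differ by the choice of `s`.
  let a : Fin 4 ↪ X := ⟨![p, q, h p, h q], by
    have := hh p; have := hh q
    intro i j; fin_cases i <;> fin_cases j <;> simp <;> grind⟩
  let b : Fin 4 ↪ X := ⟨![p, g p, r, s], by
    have := hg p
    intro i j; fin_cases i <;> fin_cases j <;> simp <;> grind⟩
  obtain ⟨σ, hσ⟩ := (Equiv.Perm.isMultiplyPretransitive X 4).exists_smul_eq a b
  have hσ' : ∀ i, σ (a i) = b i := fun i => by rw [← hσ]; rfl
  have e0 : σ p = p := hσ' 0
  have e1 : σ q = g p := hσ' 1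
  have e2 : σ (h p) = r := hσ' 2
  have e3 : σ (h q) = s := hσ' 3
  have i0 : σ⁻¹ p = p := by rw [Equiv.Perm.inv_eq_iff_eq, e0]
  have i1 : σ⁻¹ (g p) = q := by rw [Equiv.Perm.inv_eq_iff_eq, e1]
  refine ⟨σ, fun hc => hs.2.2.2 ?_⟩
  have := congrArg (fun τ : Equiv.Perm X => τ p) hc
  simp only [Equiv.Perm.mul_apply, i0, i1, e2, e3] at this
  exact this.symm

/-- The commutator of a nontrivial word with the conjugate of another one by a new variable is
nontrivial. -/
theorem commutator_conj_ne_one {α : Type*} {w₁ w₂ : FreeGroup α} (h₁ : w₁ ≠ 1) (h₂ : w₂ ≠ 1) :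
    ⁅FreeGroup.map some w₁,
      FreeGroup.of none * FreeGroup.map some w₂ * (FreeGroup.of none)⁻¹⁆ ≠ 1 := by
  have : Nonempty α := by
    by_contra hα
    rw [not_nonempty_iff] at hα
    exact h₁ (Subsingleton.elim _ _)
  -- Under left translation nontrivial words act without fixed points on the infinite set `FreeGroup
  -- α`. The new variable is sent to a permutation `σ` that breaks commutation.
  let ρ : FreeGroup α →* Equiv.Perm (FreeGroup α) := MulAction.toPermHom _ _
  obtain ⟨σ, hσ⟩ := exists_conj_not_commute (g := ρ w₁) (h := ρ w₂)
    (fun x hx => h₁ (by simpa [ρ] using hx)) (fun x hx => h₂ (by simpa [ρ] using hx))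
  let Φ : FreeGroup (Option α) →* Equiv.Perm (FreeGroup α) :=
    FreeGroup.lift fun o => o.elim σ fun a => ρ (FreeGroup.of a)
  have hΦ : ∀ w, Φ (FreeGroup.map some w) = ρ w := fun w => by
    rw [freeGroup_lift_map]
    have := map_freeGroup_lift ρ FreeGroup.of w
    rw [FreeGroup.lift_of_apply] at this
    rw [this]
    rfl
  intro h
  rw [commutatorElement_eq_one_iff_mul_comm] at h
  apply hσ
  have := congrArg Φ h
  simpa [hΦ, Φ] using this

/-- For finitely many nontrivial words there is a nontrivial word which is an identity of every
group in which each tuple is a zero of one of the given words. -/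
theorem exists_word_of_list {α : Type} [Nonempty α] [Finite α] (l : List (FreeGroup α))
    (hl : ∀ w ∈ l, w ≠ 1) :
    ∃ (β : Type) (_ : Finite β) (ι : α → β) (_ : Function.Injective ι) (W : FreeGroup β), W ≠ 1 ∧
      ∀ (G : Type u) [Group G] (g : β → G),
        (∃ w ∈ l, FreeGroup.lift (g ∘ ι) w = 1) → FreeGroup.lift g W = 1 := by
  induction l with
  | nil =>
    exact ⟨α, inferInstance, id, Function.injective_id, FreeGroup.of (Classical.arbitrary α),
      FreeGroup.of_ne_one _, by simp⟩
  | cons w l ih =>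
    obtain ⟨β, _, ι, hι, W, hW, h⟩ := ih fun w hw => hl w (List.mem_cons_of_mem _ hw)
    have hw : FreeGroup.map ι w ≠ 1 := fun hw => hl w List.mem_cons_self
      (FreeGroup.map_injective hι (hw.trans (map_one _).symm))
    refine ⟨Option β, inferInstance, some ∘ ι, (Option.some_injective _).comp hι, _,
      commutator_conj_ne_one hw hW, fun G _ g hg => ?_⟩
    simp only [map_commutatorElement, map_mul, map_inv, freeGroup_lift_map]
    rw [List.exists_mem_cons_iff] at hg
    rcases hg with hg | hg
    · have : FreeGroup.lift ((g ∘ some) ∘ ι) w = 1 := hg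
      rw [this, commutatorElement_one_left]
    · rw [h G (g ∘ some) hg]
      simp

/-- Turns a failure of compactness into an identity. Since every pair kills some word of `S`, the
embedding of the two original variables among the new ones no longer matters. -/
theorem exists_word_of_finite {S : Set (FreeGroup (Fin 2))} (hS : S.Finite)
    (hS1 : ∀ w ∈ S, w ≠ 1) :
    ∃ (n : ℕ) (W : FreeGroup (Fin n)), W ≠ 1 ∧ ∀ (G : Type u) [Group G],
      (∀ g : Fin 2 → G, ∃ w ∈ S, FreeGroup.lift g w = 1) →
        ∀ g : Fin n → G, FreeGroup.lift g W = 1 := by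
  obtain ⟨β, _, ι, -, W, hW, h⟩ := exists_word_of_list.{u} hS.toFinset.toList (by simpa using hS1)
  let e := Finite.equivFin β
  refine ⟨Nat.card β, FreeGroup.map e W, fun h1 => hW ?_, fun G _ hG g => ?_⟩
  · exact FreeGroup.map_injective e.injective (h1.trans (map_one _).symm)
  · rw [freeGroup_lift_map]
    exact h G _ (by simpa using hG _)

/-- A group in which every nontrivial word has a nonzero at a fixed pair contains a free group. -/
theorem containsFreeGroup_of_forall_ne_one {G : Type u} [Group G] (g : Fin 2 → G)
    (hg : ∀ w : FreeGroup (Fin 2), w ≠ 1 → FreeGroup.lift g w ≠ 1) : ContainsFreeGroup G :=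
  ⟨FreeGroup.lift g, (injective_iff_map_eq_one _).2 fun w hw => by
    by_contra h
    exact hg w h hw⟩

end Words

/-! ### Residually finite groups with an identity -/

section ResiduallyFinite

/-- Finite index normal subgroups of the factors pull back along the coordinate projections. -/
theorem residuallyFinite_pi {I : Type*} (F : I → Type*) [∀ i, Group (F i)]
    [∀ i, Group.ResiduallyFinite (F i)] : Group.ResiduallyFinite (∀ i, F i) := by
  rw [Group.residuallyFinite_iff_forall_finiteIndexNormalSubgroup]
  intro g hg
  funext i
  exact Group.eq_one_iff_forall_finiteIndexNormalSubroup (g i) fun K =>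
    hg (K.comap (Pi.evalMonoidHom F i))

theorem freeGroup_lift_apply_pi {α I : Type*} (F : I → Type*) [∀ i, Group (F i)]
    (g : α → ∀ i, F i) (w : FreeGroup α) (i : I) :
    FreeGroup.lift g w i = FreeGroup.lift (fun a => g a i) w :=
  map_freeGroup_lift (Pi.evalMonoidHom F i) g w

/-- If the finitely generated residually finite groups with an identity are amenable, then so are
the finitely generated subgroups of products of residually finite groups satisfying a common
identity. -/
theorem isAmenableGroup_range_lift_pi
    (h : ∀ (G : Type u) [Group G], Group.FG G → Group.ResiduallyFinite G →
      SatisfiesNontrivialIdentity G → IsAmenableGroup G)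
    {n : ℕ} {W : FreeGroup (Fin n)} (hW : W ≠ 1) {I : Type} (F : I → Type u) [∀ i, Group (F i)]
    [∀ i, Group.ResiduallyFinite (F i)] (hF : ∀ i (g : Fin n → F i), FreeGroup.lift g W = 1)
    {m : ℕ} (b : Fin m → ∀ i, F i) : IsAmenableGroup (FreeGroup.lift b).range := by
  have := residuallyFinite_pi F
  refine h _ inferInstance inferInstance ⟨n, W, hW, fun g => Subtype.ext ?_⟩
  have := map_freeGroup_lift (FreeGroup.lift b).range.subtype g W
  refine this.trans ?_
  funext i
  rw [freeGroup_lift_apply_pi]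
  exact hF i _

open scoped Classical Pointwise in
/-- A group satisfying an identity which can be approximated, one inequation at a time, by finite
groups satisfying that identity is amenable if the finitely generated residually finite groups
with an identity are. -/
theorem isAmenableGroup_of_approximable
    (h : ∀ (G : Type u) [Group G], Group.FG G → Group.ResiduallyFinite G →
      SatisfiesNontrivialIdentity G → IsAmenableGroup G)
    {n : ℕ} {W : FreeGroup (Fin n)} (hW : W ≠ 1) (G : Type u) [Group G]
    (hG : ∀ (m : ℕ) (a : Fin m → G) (w : FreeGroup (Fin m)), FreeGroup.lift a w ≠ 1 →
      ∃ (F : Type u) (_ : Group F) (_ : Finite F), (∀ g : Fin n → F, FreeGroup.lift g W = 1) ∧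
        ∃ b : Fin m → F, FreeGroup.lift b w ≠ 1) :
    IsAmenableGroup G := by
  refine isAmenableGroup_of_folner fun ε hε A => ?_
  let a : Fin A.card → G := fun i => A.equivFin.symm i
  -- One finite group for each word not vanishing at `a`. Every relation of the tuple `c` in the
  -- product is then a relation of `a`, so the group generated by `a` is a quotient of the one
  -- generated by `c`.
  choose F hFg hFfin hF b hb using fun w : {w // FreeGroup.lift a w ≠ 1} => hG _ a w.1 w.2
  let c : Fin A.card → ∀ w, F w := fun i w => b w i
  have hH := isAmenableGroup_range_lift_pi h hW F hF c
  have hker : ∀ w, FreeGroup.lift c w = 1 → FreeGroup.lift a w = 1 := fun w hw => by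
    by_contra hwa
    apply hb ⟨w, hwa⟩
    have := congrFun hw ⟨w, hwa⟩
    rwa [freeGroup_lift_apply_pi] at this
  have hker' : ∀ w w', FreeGroup.lift c w = FreeGroup.lift c w' →
      FreeGroup.lift a w = FreeGroup.lift a w' := fun w w' hw => by
    rw [← mul_inv_eq_one, ← map_inv, ← map_mul] at hw ⊢
    exact hker _ hw
  choose word hword using fun x : (FreeGroup.lift c).range => x.2
  have hK : IsAmenableGroup (FreeGroup.lift a).range := by
    refine hH.of_equivariant (fun x => ⟨FreeGroup.lift a (word x), _, rfl⟩) ?_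
    rintro ⟨_, w, rfl⟩
    refine ⟨⟨_, w, rfl⟩, fun x => Subtype.ext ?_⟩
    change FreeGroup.lift a _ = FreeGroup.lift a w * FreeGroup.lift a (word x)
    rw [← map_mul]
    apply hker'
    rw [hword, map_mul, hword]
    rfl
  have hA : ∀ x ∈ A, x ∈ (FreeGroup.lift a).range := fun x hx =>
    ⟨FreeGroup.of (A.equivFin ⟨x, hx⟩), by simp [a]⟩
  obtain ⟨V, hV⟩ := hK.exists_folner hε (A.attach.image
    fun x : A => (⟨x.1, hA _ x.2⟩ : (FreeGroup.lift a).range))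
  obtain ⟨V', -, hV'⟩ := exists_folner_of_monoidHom (FreeGroup.lift a).range.subtype hV (B := A)
    (fun x hx => ⟨⟨x, hA x hx⟩, by simpa using hx, rfl⟩)
  exact ⟨V', hV'⟩

open scoped Classical Pointwise in
-- If no bound `k` works for `ε` and `m`, the counterexamples `A k` are the coordinates of an
-- `m`-tuple in `ℕ → G`. The subgroup it generates has a Følner set `V`, whose size picks out the
-- coordinate to project to: there it contradicts the choice of `A V.card`.
theorem isUniformlyAmenableGroup_of_satisfiesNontrivialIdentity
    (h : ∀ (G : Type u) [Group G], Group.FG G → Group.ResiduallyFinite G →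
      SatisfiesNontrivialIdentity G → IsAmenableGroup G)
    (G : Type u) [Group G] [Group.ResiduallyFinite G] (hG : SatisfiesNontrivialIdentity G) :
    IsUniformlyAmenableGroup G := by
  obtain ⟨n, W, hW, hGW⟩ := hG
  have key : ∀ (ε : ℝ) (m : ℕ), 0 < ε → ∃ k : ℕ, ∀ A : Finset G, A.card = m →
      ∃ V : Finset G, V.card ≤ k ∧ ((A * V).card : ℝ) < (1 + ε) * V.card := by
    intro ε m hε
    by_contra! hcon
    choose A hAm hA using hcon
    let c : Fin m → ℕ → G := fun i k => (Finset.equivFinOfCardEq (hAm k)).symm i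
    have hH := isAmenableGroup_range_lift_pi h hW (fun _ => G) (fun _ => hGW) c
    have hc : ∀ i, c i ∈ (FreeGroup.lift c).range := fun i => ⟨FreeGroup.of i, by simp⟩
    obtain ⟨V, hV⟩ := hH.exists_folner hε (Finset.univ.image
      fun i => (⟨c i, hc i⟩ : (FreeGroup.lift c).range))
    obtain ⟨V', hVV', hV'⟩ := exists_folner_of_monoidHom
      ((Pi.evalMonoidHom (fun _ => G) V.card).comp (FreeGroup.lift c).range.subtype) hV
      (B := A V.card) (fun x hx => ⟨_, Finset.mem_image_of_mem _
        (Finset.mem_univ (Finset.equivFinOfCardEq (hAm V.card) ⟨x, hx⟩)), by simp [c]⟩)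
    exact (hA V.card V' hVV').not_gt hV'
  choose! α hα using key
  exact ⟨α, fun ε hε _ A => hα ε A.card hε A rfl⟩

end ResiduallyFinite

/-! ### A diagonal argument -/

section Diagonal

/-- A decreasing sequence of conditions on the factors of a product, which eventually become
constant on each factor, and each of which is satisfiable on almost all factors, is satisfied by a
single element of the product, each condition on almost all factors. -/
theorem exists_diagonal {I : Type*} (U : Filter I) {X : I → Type*} [∀ i, Nonempty (X i)]
    (Q : ℕ → ∀ i, X i → Prop) (hanti : ∀ k l i x, k ≤ l → Q l i x → Q k i x)
    (hstab : ∀ i, ∃ N, ∀ x, Q N i x → ∀ k, Q k i x)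
    (hex : ∀ k, ∀ᶠ i in U, ∃ x, Q k i x) :
    ∃ x : ∀ i, X i, ∀ k, ∀ᶠ i in U, Q k i (x i) := by
  classical
  -- On each factor, satisfy as many conditions as possible: all of them by stabilization, or else
  -- those before the first unsatisfiable one.
  have key : ∀ i, ∃ x : X i, ∀ k, (∃ y, Q k i y) → Q k i x := by
    intro i
    by_cases hall : ∀ k, ∃ y, Q k i y
    · obtain ⟨N, hN⟩ := hstab i
      obtain ⟨y, hy⟩ := hall N
      exact ⟨y, fun k _ => hN y hy k⟩
    · push Not at hall
      have hfind := Nat.find_spec hall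
      have hlt : ∀ k, (∃ y, Q k i y) → k < Nat.find hall := by
        rintro k ⟨y, hy⟩
        by_contra hk
        exact hfind y (hanti _ _ _ _ (not_lt.1 hk) hy)
      rcases Nat.eq_zero_or_pos (Nat.find hall) with h0 | hpos
      · exact ⟨Classical.arbitrary _, fun k hk => absurd (hlt k hk) (by omega)⟩
      · have := Nat.find_min hall (Nat.sub_lt hpos one_pos)
        push Not at this
        obtain ⟨y, hy⟩ := this
        exact ⟨y, fun k hk => hanti _ _ _ _ (Nat.le_sub_one_of_lt (hlt k hk)) hy⟩
  choose x hx using key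
  exact ⟨x, fun k => (hex k).mono fun i hi => hx i k hi⟩

end Diagonal

/-! ### Ultraproducts of finite groups -/

section Ultraproducts

/-- The projection from a product of groups to an ultraproduct. -/
def GroupUltraproduct.mk {I : Type u} (U : Ultrafilter I) (F : I → Type v) [∀ i, Group (F i)] :
    (∀ i, F i) →* GroupUltraproduct U F where
  toFun := Quotient.mk ((U : Filter I).productSetoid F)
  map_one' := rfl
  map_mul' _ _ := rfl

namespace GroupUltraproduct

variable {I : Type u} (U : Ultrafilter I) (F : I → Type v) [∀ i, Group (F i)]

theorem mk_surjective : Function.Surjective (mk U F) := Quotient.mk_surjective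

theorem mk_eq_one_iff (x : ∀ i, F i) : mk U F x = 1 ↔ ∀ᶠ i in (U : Filter I), x i = 1 :=
  Quotient.eq (r := (U : Filter I).productSetoid F) (x := x) (y := 1)

theorem lift_mk_eq_one_iff {α : Type*} (x : α → ∀ i, F i) (w : FreeGroup α) :
    FreeGroup.lift (fun a => mk U F (x a)) w = 1 ↔
      ∀ᶠ i in (U : Filter I), FreeGroup.lift (fun a => x a i) w = 1 := by
  have := map_freeGroup_lift (mk U F) x w
  rw [show (fun a => mk U F (x a)) = mk U F ∘ x from rfl, ← this, mk_eq_one_iff]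
  simp only [freeGroup_lift_apply_pi]

theorem lift_eq_one_of_eventually {α : Type*} {w : FreeGroup α}
    (h : ∀ᶠ i in (U : Filter I), ∀ g : α → F i, FreeGroup.lift g w = 1)
    (g : α → GroupUltraproduct U F) : FreeGroup.lift g w = 1 := by
  choose x hx using fun a => mk_surjective U F (g a)
  rw [← funext hx, lift_mk_eq_one_iff]
  exact h.mono fun i hi => hi _

/-- An ultraproduct of finite groups contains a free group, or almost all of the factors satisfy a
common nontrivial identity. -/
theorem containsFreeGroup_or_eventually_identity [∀ i, Finite (F i)] :
    ContainsFreeGroup (GroupUltraproduct U F) ∨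
      ∃ (n : ℕ) (W : FreeGroup (Fin n)), W ≠ 1 ∧
        ∀ᶠ i in (U : Filter I), ∀ g : Fin n → F i, FreeGroup.lift g W = 1 := by
  have : Countable (FreeGroup (Fin 2)) := Quot.mk_surjective.countable
  have : Nonempty {w : FreeGroup (Fin 2) // w ≠ 1} := ⟨⟨FreeGroup.of 0, FreeGroup.of_ne_one _⟩⟩
  obtain ⟨e, he⟩ := exists_surjective_nat {w : FreeGroup (Fin 2) // w ≠ 1}
  let Q : ℕ → ∀ i, (Fin 2 → F i) → Prop := fun k i x => ∀ j < k, FreeGroup.lift x (e j).1 ≠ 1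
  by_cases hex : ∀ k, ∀ᶠ i in (U : Filter I), ∃ x, Q k i x
  · left
    obtain ⟨x, hx⟩ := exists_diagonal (U : Filter I) Q
      (fun k l i x hkl h j hj => h j (hj.trans_le hkl)) (fun i => by
        -- Stabilization is vacuous: the `Nat.card (F i)`-th power of a generator is a nontrivial
        -- word vanishing on `F i`, so `Q` fails on `F i` once this word is included.
        have hw : (FreeGroup.of (0 : Fin 2)) ^ Nat.card (F i) ≠ 1 := by
          rw [Ne, pow_eq_one_iff_left Nat.card_pos.ne']
          exact FreeGroup.of_ne_one _
        obtain ⟨j, hj⟩ := he ⟨_, hw⟩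
        refine ⟨j + 1, fun x h => absurd ?_ (h j j.lt_succ_self)⟩
        rw [hj, map_pow, pow_card_eq_one']) hex
    refine containsFreeGroup_of_forall_ne_one (fun a => mk U F fun i => x i a) fun w hw h => ?_
    obtain ⟨j, hj⟩ := he ⟨w, hw⟩
    rw [lift_mk_eq_one_iff] at h
    obtain ⟨i, hi, hi'⟩ := (h.and (hx (j + 1))).exists
    exact hi' j j.lt_succ_self (by rw [hj]; exact hi)
  · right
    push Not at hex
    obtain ⟨k, hk⟩ := hex
    obtain ⟨n, W, hW, h⟩ := exists_word_of_finite.{v}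
      ((Set.finite_lt_nat k).image fun j => (e j).1) (by rintro _ ⟨j, -, rfl⟩; exact (e j).2)
    refine ⟨n, W, hW, ?_⟩
    filter_upwards [hk] with i hi
    refine h _ fun g => ?_
    have := hi g
    simp only [Q] at this
    push Not at this
    obtain ⟨j, hj, hj'⟩ := this
    exact ⟨_, ⟨j, hj, rfl⟩, hj'⟩

end GroupUltraproduct

/-- If finitely generated residually finite groups with an identity are amenable, then
ultraproducts of finite groups contain a free group or are amenable. -/
theorem containsFreeGroup_or_isAmenableGroup_ultraproduct
    (h : ∀ (G : Type u) [Group G], Group.FG G → Group.ResiduallyFinite G →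
      SatisfiesNontrivialIdentity G → IsAmenableGroup G)
    (I : Type u) (U : Ultrafilter I) (F : I → Type u) [∀ i, Group (F i)] [∀ i, Finite (F i)] :
    ContainsFreeGroup (GroupUltraproduct U F) ∨ IsAmenableGroup (GroupUltraproduct U F) := by
  refine (GroupUltraproduct.containsFreeGroup_or_eventually_identity U F).imp_right ?_
  rintro ⟨n, W, hW, hU⟩
  refine isAmenableGroup_of_approximable h hW _ fun m a w haw => ?_
  choose x hx using fun j => GroupUltraproduct.mk_surjective U F (a j)
  rw [← funext hx, Ne, GroupUltraproduct.lift_mk_eq_one_iff, ← Ultrafilter.eventually_not] at haw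
  obtain ⟨i, hi, hi'⟩ := (hU.and haw).exists
  exact ⟨F i, inferInstance, inferInstance, hi, _, hi'⟩

/-- A group with an identity, each nontrivial element of which survives in almost all members of a
family of quotients, embeds into their ultraproduct and is amenable if that ultraproduct contains a
free group or is amenable. -/
theorem IsAmenableGroup.of_ultraproduct_quotients {G : Type u} [Group G]
    (hG : SatisfiesNontrivialIdentity G) {I : Type v} (U : Ultrafilter I) (N : I → Subgroup G)
    [∀ i, (N i).Normal] (hN : ∀ g : G, g ≠ 1 → ∀ᶠ i in (U : Filter I), g ∉ N i)
    (h : ContainsFreeGroup (GroupUltraproduct U fun i => G ⧸ N i) ∨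
      IsAmenableGroup (GroupUltraproduct U fun i => G ⧸ N i)) : IsAmenableGroup G := by
  rcases h with h | h
  -- The identity passes to all quotients and hence to their ultraproduct, which excludes a free
  -- subgroup.
  · obtain ⟨n, W, hW, hGW⟩ := hG
    refine absurd ⟨n, W, hW, ?_⟩ h.not_satisfiesNontrivialIdentity
    refine GroupUltraproduct.lift_eq_one_of_eventually U _ (Filter.Eventually.of_forall ?_)
    intro i g
    choose x hx using fun a => QuotientGroup.mk'_surjective (N i) (g a)
    rw [← funext hx]
    refine (map_freeGroup_lift (QuotientGroup.mk' (N i)) x W).symm.trans ?_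
    rw [hGW, map_one]
  · refine h.of_injective ((GroupUltraproduct.mk U fun i => G ⧸ N i).comp
      (MonoidHom.pi fun i => QuotientGroup.mk' (N i))) ?_
    rw [injective_iff_map_eq_one]
    intro g hg
    by_contra hg1
    rw [MonoidHom.comp_apply, GroupUltraproduct.mk_eq_one_iff] at hg
    obtain ⟨i, hi, hi'⟩ := (hg.and (hN g hg1)).exists
    exact hi' ((QuotientGroup.eq_one_iff g).1 hi)

/-- If ultraproducts of finite groups contain a free group or are amenable, then residually
finite groups with an identity are amenable. -/
theorem isAmenableGroup_of_residuallyFinite_of_ultraproduct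
    (h : ∀ (I : Type u) (U : Ultrafilter I) (F : I → Type u) [∀ i, Group (F i)]
      [∀ i, Finite (F i)],
      ContainsFreeGroup (GroupUltraproduct U F) ∨ IsAmenableGroup (GroupUltraproduct U F))
    (G : Type u) [Group G] [Group.ResiduallyFinite G] (hG : SatisfiesNontrivialIdentity G) :
    IsAmenableGroup G := by
  -- Under reverse inclusion, an ultrafilter refining `atTop` makes almost all indices lie inside
  -- any given finite index normal subgroup.
  let I := (FiniteIndexNormalSubgroup G)ᵒᵈ
  have : Nonempty I := ⟨OrderDual.toDual (FiniteIndexNormalSubgroup.ofSubgroup ⊤)⟩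
  have : IsDirected I (· ≤ ·) := ⟨fun a b => ⟨a ⊔ b, le_sup_left, le_sup_right⟩⟩
  let U : Ultrafilter I := Ultrafilter.of Filter.atTop
  refine hG.elim fun _ _ => IsAmenableGroup.of_ultraproduct_quotients hG U
    (fun i => (OrderDual.ofDual i).toSubgroup) (fun g hg => ?_) (h I U _)
  obtain ⟨K, hK⟩ := Group.exists_finiteIndexNormalSubgroup_notMem g hg
  have : ∀ᶠ i in (U : Filter I), OrderDual.toDual K ≤ i :=
    Ultrafilter.of_le _ (Filter.eventually_ge_atTop _)
  exact this.mono fun i hi hgi => hK (hi hgi)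

end Ultraproducts

/-! ### Saturation, pseudofiniteness and Łoś's theorem -/

section FirstOrderLogic

open FirstOrder.Language

instance groupLanguage.countable_symbols : Countable groupLanguage.Symbols := by
  have h1 : ∀ n, Countable (groupLanguage.Functions n) := fun n => by
    refine Function.Injective.countable (β := ℕ)
      (f := fun f : GroupFunc n => match f with
        | GroupFunc.one => 0
        | GroupFunc.inv => 1
        | GroupFunc.mul => 2) ?_
    rintro (_ | _ | _) b h <;> cases b <;> rfl
  have h2 : ∀ n, Countable (groupLanguage.Relations n) := fun n =>
    inferInstanceAs (Countable Empty)
  exact inferInstanceAs (Countable ((Σ n, groupLanguage.Functions n) ⊕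
    (Σ n, groupLanguage.Relations n)))

/-- Every word is the interpretation of a term of the language of groups. -/
theorem exists_term_of_word {α : Type} (w : FreeGroup α) :
    ∃ t : groupLanguage.Term α, ∀ (G : Type u) [Group G] (g : α → G),
      @Term.realize _ _ (groupStructure G) _ g t = FreeGroup.lift g w := by
  have hinv : ∀ w : FreeGroup α, (∃ t : groupLanguage.Term α, ∀ (G : Type u) [Group G] (g : α → G),
      @Term.realize _ _ (groupStructure G) _ g t = FreeGroup.lift g w) →
      ∃ t : groupLanguage.Term α, ∀ (G : Type u) [Group G] (g : α → G),
      @Term.realize _ _ (groupStructure G) _ g t = FreeGroup.lift g w⁻¹ := by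
    rintro w ⟨t, ht⟩
    refine ⟨Term.func (L := groupLanguage) GroupFunc.inv ![t], fun G _ g => ?_⟩
    rw [map_inv, ← ht]
    rfl
  induction w using FreeGroup.induction_on with
  | C1 =>
    refine ⟨Term.func (L := groupLanguage) GroupFunc.one ![], fun G _ g => ?_⟩
    rw [map_one]
    rfl
  | of a =>
    refine ⟨Term.var a, fun G _ g => ?_⟩
    rw [FreeGroup.lift_apply_of]
    rfl
  | inv_of a ih => exact hinv _ ih
  | mul x y hx hy =>
    obtain ⟨s, hs⟩ := hx
    obtain ⟨t, ht⟩ := hy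
    refine ⟨Term.func (L := groupLanguage) GroupFunc.mul ![s, t], fun G _ g => ?_⟩
    rw [map_mul, ← ht, ← hs]
    rfl

/-- The vanishing of a word is expressed by a formula. -/
theorem exists_formula_of_word {α : Type} (w : FreeGroup α) :
    ∃ φ : groupLanguage.Formula α, ∀ (G : Type u) [Group G] (g : α → G),
      @Formula.Realize _ _ (groupStructure G) _ φ g ↔ FreeGroup.lift g w = 1 := by
  obtain ⟨t, ht⟩ := exists_term_of_word.{u} w
  obtain ⟨s, hs⟩ := exists_term_of_word.{u} (1 : FreeGroup α)
  refine ⟨t.equal s, fun G _ g => ?_⟩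
  let _ := groupStructure G
  rw [Formula.realize_equal, ht, hs, map_one]

/-- An implication between identities is expressed by a sentence. -/
theorem exists_sentence_of_words {m n : ℕ} (W : FreeGroup (Fin n)) (w : FreeGroup (Fin m)) :
    ∃ σ : groupLanguage.Sentence, ∀ (G : Type u) [Group G], GroupSatisfies G σ ↔
      ((∀ g : Fin n → G, FreeGroup.lift g W = 1) → ∀ g : Fin m → G, FreeGroup.lift g w = 1) := by
  obtain ⟨φ, hφ⟩ := exists_formula_of_word.{u} W
  obtain ⟨ψ, hψ⟩ := exists_formula_of_word.{u} w
  let all : ∀ {k : ℕ}, groupLanguage.Formula (Fin k) → groupLanguage.Sentence := fun {k} χ =>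
    Formula.iAlls (Fin k) (χ.relabel Sum.inr : groupLanguage.Formula (Empty ⊕ Fin k))
  refine ⟨(all φ).imp (all ψ), fun G _ => ?_⟩
  let _ := groupStructure G
  have hall : ∀ {k : ℕ} (χ : groupLanguage.Formula (Fin k)),
      @Formula.Realize _ G _ _ (all χ) default ↔ ∀ g : Fin k → G, χ.Realize g := by
    intro k χ
    simp only [all, Formula.realize_iAlls, Formula.realize_relabel]
    rfl
  unfold GroupSatisfies Sentence.Realize
  rw [Formula.realize_imp, hall, hall]
  simp only [hφ, hψ]

/-- An `ℵ₀`-saturated group contains a free group or satisfies a nontrivial identity. -/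
theorem IsAlephZeroSaturatedGroup.containsFreeGroup_or_identity {G : Type u} [Group G]
    (hG : IsAlephZeroSaturatedGroup G) :
    ContainsFreeGroup G ∨ SatisfiesNontrivialIdentity G := by
  let _ := groupStructure G
  choose φ hφ using fun w : FreeGroup (Fin 2) => exists_formula_of_word.{u} w
  -- The type, without parameters, of a free pair.
  let ψ : FreeGroup (Fin 2) → (groupLanguage.withConstants (∅ : Set G)).Formula (Fin 2) :=
    fun w => (groupLanguage.lhomWithConstants (∅ : Set G)).onFormula (φ w).not
  have hψ : ∀ w (g : Fin 2 → G), (ψ w).Realize g ↔ FreeGroup.lift g w ≠ 1 := fun w g => by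
    simp only [ψ, LHom.realize_onFormula, Formula.realize_not, hφ]
  by_cases hfin : ∀ q : Set ((groupLanguage.withConstants (∅ : Set G)).Formula (Fin 2)),
      q ⊆ ψ '' {w | w ≠ 1} → q.Finite → ∃ v : Fin 2 → G, ∀ χ ∈ q, χ.Realize v
  · left
    obtain ⟨g, hg⟩ := hG ∅ Set.finite_empty 2 _ hfin
    exact containsFreeGroup_of_forall_ne_one g fun w hw => (hψ w g).1 (hg _ ⟨w, hw, rfl⟩)
  · right
    push Not at hfin
    obtain ⟨S, hS, hSfin, hS'⟩ := Set.exists_subset_image_finite_and.1 hfin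
    obtain ⟨n, W, hW, h⟩ := exists_word_of_finite.{u} hSfin hS
    refine ⟨n, W, hW, h G fun g => ?_⟩
    obtain ⟨_, ⟨w, hw, rfl⟩, hwg⟩ := hS' g
    exact ⟨w, hw, by simpa [hψ] using hwg⟩

/-- If finitely generated residually finite groups with an identity are amenable, then
`ℵ₀`-saturated pseudofinite groups contain a free group or are amenable. -/
theorem containsFreeGroup_or_isAmenableGroup_of_pseudofinite
    (h : ∀ (G : Type u) [Group G], Group.FG G → Group.ResiduallyFinite G →
      SatisfiesNontrivialIdentity G → IsAmenableGroup G)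
    (G : Type u) [Group G] (hsat : IsAlephZeroSaturatedGroup G) (hpf : IsPseudofiniteGroup G) :
    ContainsFreeGroup G ∨ IsAmenableGroup G := by
  refine hsat.containsFreeGroup_or_identity.imp_right ?_
  rintro ⟨n, W, hW, hGW⟩
  refine isAmenableGroup_of_approximable h hW G fun m a w haw => ?_
  -- If every finite group with identity `W` also had identity `w`, this implication would transfer
  -- to `G`, contradicting the fact that `w` does not vanish at `a`.
  obtain ⟨σ, hσ⟩ := exists_sentence_of_words.{u} W w
  by_contra! hcon
  exact haw ((hσ G).1 (hpf σ fun F _ _ => (hσ F).2 fun hF => hcon F _ inferInstance hF) hGW a)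

theorem realize_constantsVarsEquiv_formula {L : FirstOrder.Language.{0, 0}} {M : Type u}
    [L.Structure M] {A : Set M} {α : Type} (φ : (L.withConstants A).Formula α) (v : α → M) :
    Formula.Realize (BoundedFormula.constantsVarsEquiv φ : L.Formula (A ⊕ α))
      (Sum.elim (fun a : A => (a : M)) v) ↔ φ.Realize v :=
  BoundedFormula.realize_constantsVarsEquiv

/-- Ultraproducts along a nonprincipal ultrafilter on the natural numbers are `ℵ₀`-saturated. -/
theorem isAlephZeroSaturated_product {L : FirstOrder.Language.{0, 0}} [Countable L.Symbols]
    (F : ℕ → Type u) [∀ i, L.Structure (F i)] [∀ i, Nonempty (F i)] :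
    IsAlephZeroSaturated L ((Filter.hyperfilter ℕ : Filter ℕ).Product F) := by
  intro A hA n p hp
  have := hA.countable.to_subtype
  rcases p.eq_empty_or_nonempty with rfl | hne
  · exact hp ∅ subset_rfl Set.finite_empty
  obtain ⟨e, rfl⟩ := (Set.to_countable p).exists_eq_range hne
  let mk : (∀ i, F i) → (Filter.hyperfilter ℕ : Filter ℕ).Product F := fun x => x
  have hmk : ∀ y, ∃ x, mk x = y := Quotient.mk_surjective
  choose out hout using hmk
  -- Parameters become variables, evaluated in the `i`-th factor at the `i`-th coordinates of chosen
  -- representatives.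
  let ψ : ℕ → L.Formula (A ⊕ Fin n) := fun k => BoundedFormula.constantsVarsEquiv (e k)
  have hψ : ∀ k (x : Fin n → ∀ i, F i), (e k).Realize (fun t => mk (x t)) ↔
      ∀ᶠ i in (Filter.hyperfilter ℕ : Filter ℕ),
        (ψ k).Realize (Sum.elim (fun a : A => out a i) fun t => x t i) := by
    intro k x
    have h1 := Ultraproduct.realize_formula_cast (u := Filter.hyperfilter ℕ) (ψ k)
      (Sum.elim (fun a : A => out a) x)
    have h2 : (fun s => mk (Sum.elim (fun a : A => out a) x s)) =
        Sum.elim (fun a : A => (a : (Filter.hyperfilter ℕ : Filter ℕ).Product F))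
          (fun t => mk (x t)) := by
      funext s
      rcases s with a | t
      · exact hout a
      · rfl
    have h3 : ∀ i, (fun s => Sum.elim (fun a : A => out a) x s i) =
        Sum.elim (fun a : A => out a i) fun t => x t i := by
      intro i
      funext s
      rcases s with a | t <;> rfl
    simp only [h3] at h1
    rw [← h1]
    refine Iff.trans ?_ (Iff.of_eq (congrArg (ψ k).Realize h2.symm))
    exact (realize_constantsVarsEquiv_formula (e k) _).symm
  -- Imposing the `j`-th formula only on factors with `j < i` makes the conditions on factor `i`
  -- stabilize at `k = i`. Only finitely many factors are lost for each formula, which a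
  -- nonprincipal ultrafilter ignores.
  let Q : ℕ → ∀ i, (Fin n → F i) → Prop := fun k i x => ∀ j, j < k → j < i →
    (ψ j).Realize (Sum.elim (fun a : A => out a i) x)
  obtain ⟨x, hx⟩ := exists_diagonal (Filter.hyperfilter ℕ : Filter ℕ) Q
    (fun k l i x hkl h j hj => h j (hj.trans_le hkl))
    (fun i => ⟨i, fun x h k j _ hji => h j hji hji⟩) (fun k => by
      obtain ⟨v, hv⟩ := hp (e '' Set.Iio k) (Set.image_subset_range _ _)
        ((Set.finite_Iio k).image e)
      have : ∀ᶠ i in (Filter.hyperfilter ℕ : Filter ℕ), ∀ j ∈ Set.Iio k,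
          (ψ j).Realize (Sum.elim (fun a : A => out a i) fun t => out (v t) i) := by
        rw [Filter.eventually_all_finite (Set.finite_Iio k)]
        intro j hj
        rw [← hψ j fun t => out (v t)]
        simp only [hout]
        exact hv _ ⟨j, hj, rfl⟩
      exact this.mono fun i hi => ⟨_, fun j hj _ => hi j hj⟩)
  refine ⟨fun t => mk fun i => x i t, ?_⟩
  rintro _ ⟨j, rfl⟩
  rw [hψ j]
  filter_upwards [hx (j + 1), Nat.hyperfilter_le_atTop (Filter.eventually_gt_atTop j)] with i hi hji
  exact hi j j.lt_succ_self hji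

/-- The group structure on an ultraproduct of groups agrees with the structure of an ultraproduct of
structures. -/
theorem groupStructure_groupUltraproduct {I : Type u} (U : Ultrafilter I) (F : I → Type v)
    [∀ i, Group (F i)] :
    groupStructure (GroupUltraproduct U F) =
      @Ultraproduct.structure I F U groupLanguage fun i => groupStructure (F i) := by
  let _ : ∀ i, groupLanguage.Structure (F i) := fun i => groupStructure (F i)
  refine Structure.ext ?_ ?_
  · funext n f x
    choose y hy using fun k => GroupUltraproduct.mk_surjective U F (x k)
    obtain rfl : (fun k => GroupUltraproduct.mk U F (y k)) = x := funext hy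
    refine Eq.trans ?_ (Ultraproduct.funMap_cast f y).symm
    cases f <;> rfl
  · funext n r
    exact Empty.elim r

theorem isAlephZeroSaturatedGroup_groupUltraproduct (F : ℕ → Type u) [∀ i, Group (F i)] :
    IsAlephZeroSaturatedGroup (GroupUltraproduct (Filter.hyperfilter ℕ) F) := by
  let _ : ∀ i, groupLanguage.Structure (F i) := fun i => groupStructure (F i)
  unfold IsAlephZeroSaturatedGroup
  rw [groupStructure_groupUltraproduct]
  exact isAlephZeroSaturated_product F

theorem isPseudofiniteGroup_groupUltraproduct {I : Type} (U : Ultrafilter I) (F : I → Type u)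
    [∀ i, Group (F i)] [∀ i, Finite (F i)] : IsPseudofiniteGroup (GroupUltraproduct U F) := by
  let _ : ∀ i, groupLanguage.Structure (F i) := fun i => groupStructure (F i)
  intro φ hφ
  unfold GroupSatisfies
  rw [groupStructure_groupUltraproduct]
  exact (Ultraproduct.sentence_realize φ).2 (Filter.Eventually.of_forall fun i => hφ (F i))

/-- If `ℵ₀`-saturated pseudofinite groups contain a free group or are amenable, then finitely
generated residually finite groups with an identity are amenable. -/
theorem isAmenableGroup_of_residuallyFinite_of_pseudofinite
    (h : ∀ (G : Type u) [Group G], IsAlephZeroSaturatedGroup G → IsPseudofiniteGroup G →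
      ContainsFreeGroup G ∨ IsAmenableGroup G)
    (G : Type u) [Group G] [Group.FG G] [Group.ResiduallyFinite G]
    (hG : SatisfiesNontrivialIdentity G) : IsAmenableGroup G := by
  obtain ⟨α, _, π, hπ⟩ := Group.fg_iff_exists_freeGroup_hom_surjective_finite.1 ‹Group.FG G›
  have : Countable (FreeGroup α) := Quot.mk_surjective.countable
  have : Countable G := hπ.countable
  obtain ⟨e, he⟩ := exists_surjective_nat G
  choose K hK using fun g : {g : G // g ≠ 1} =>
    Group.exists_finiteIndexNormalSubgroup_notMem g.1 g.2
  classical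
  -- `M j` omits `e j` when that element is nontrivial. The intersection `N i` of `M 0, …, M i`
  -- therefore omits every nontrivial `e j` with `j ≤ i`.
  let M : ℕ → FiniteIndexNormalSubgroup G := fun j => if hj : e j ≠ 1 then K ⟨e j, hj⟩ else .ofSubgroup ⊤
  let N : ℕ → FiniteIndexNormalSubgroup G := fun i => (Finset.range (i + 1)).inf' ⟨0, by simp⟩ M
  refine IsAmenableGroup.of_ultraproduct_quotients hG (Filter.hyperfilter ℕ)
    (fun i => (N i).toSubgroup) (fun g hg => ?_) (h _
      (isAlephZeroSaturatedGroup_groupUltraproduct _) (isPseudofiniteGroup_groupUltraproduct _ _))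
  obtain ⟨j, rfl⟩ := he g
  filter_upwards [Nat.hyperfilter_le_atTop (Filter.eventually_ge_atTop j)] with i hi hgi
  have hle : N i ≤ M j := Finset.inf'_le _ (Finset.mem_range.2 (Nat.lt_succ_of_le hi))
  have hMj : M j = K ⟨e j, hg⟩ := dif_pos hg
  exact hK ⟨e j, hg⟩ (hMj ▸ hle hgi)

end FirstOrderLogic

theorem theorem5p1 :
    List.TFAE [
      ∀ (G : Type u) [Group G], IsAlephZeroSaturatedGroup G → IsPseudofiniteGroup G →
        ContainsFreeGroup G ∨ IsAmenableGroup G,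
      ∀ (I : Type u) (U : Ultrafilter I) (F : I → Type u) [∀ i, Group (F i)] [∀ i, Finite (F i)],
        ContainsFreeGroup (GroupUltraproduct U F) ∨ IsAmenableGroup (GroupUltraproduct U F),
      ∀ (G : Type u) [Group G], Group.FG G → Group.ResiduallyFinite G →
        SatisfiesNontrivialIdentity G → IsAmenableGroup G,
      ∀ (G : Type u) [Group G], Group.FG G → Group.ResiduallyFinite G →
        SatisfiesNontrivialIdentity G → IsUniformlyAmenableGroup G] := by
  tfae_have 1 → 3 := fun h G _ _ _ hG => isAmenableGroup_of_residuallyFinite_of_pseudofinite h G hG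
  tfae_have 3 → 1 := fun h => containsFreeGroup_or_isAmenableGroup_of_pseudofinite h
  tfae_have 2 → 3 := fun h G _ _ _ hG => isAmenableGroup_of_residuallyFinite_of_ultraproduct h G hG
  tfae_have 3 → 2 := fun h => containsFreeGroup_or_isAmenableGroup_ultraproduct h
  tfae_have 3 → 4 := fun h G _ _ _ hG =>
    isUniformlyAmenableGroup_of_satisfiesNontrivialIdentity h G hG
  tfae_have 4 → 3 := fun h G _ hfg hrf hG => (h G hfg hrf hG).isAmenableGroup
  tfae_finish
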